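/- Let $V$ be a finite set of $v$ points. A $(v,k,\lambda)$-covering on $V$ is a collection $\mathcal B$ of $k$-subsets of $V$ (blocks, repetition allowed) such that any two distinct points $x,y$ lie together in $r_{xy}\ge\lambda$ blocks; it is symmetric if it has exactly $v$ blocks. Its excess is the multigraph on $V$ in which distinct points $x,y$ are joined by $r_{xy}-\lambda$ edges. A pair of parallel edges is regarded as a cycle of length $2$. Let $t_2$, $t_3$ and $k$ be positive integers such that $k>3$ and $2t_2+3t_3=k(k-1)-1$. There does not exist a symmetric $(2t_2+3t_3,k,1)$-covering whose excess is a vertex-disjoint union of exactly $t_2$ cycles of length $2$ and $t_3$ cycles of length $3$ (together covering all points) if (i) $k\equiv 0\pmod 4$ and $t_3\equiv 1\pmod 4$; or (ii) $k\equiv 1\pmod 4$ and $t_3\equiv 5\pmod 8$. -/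

import Mathlib

/-- A loopless multigraph on the vertex set `V`, given by its edge multiplicities:
`mult x y` is the number of edges joining `x` and `y`. -/
structure LooplessMultigraph (V : Type*) where
  mult : V → V → ℕ
  symm : ∀ x y, mult x y = mult y x
  loopless : ∀ x, mult x x = 0

namespace LooplessMultigraph

/-- The cycle of length `n` (for `2 ≤ n`) on the vertices `0, …, n - 1`: for each `a` there is one
edge joining `a` and `a + 1` modulo `n`. For `n = 2` this is a pair of parallel edges. -/
def cycle (n : ℕ) : LooplessMultigraph (Fin n) where
  mult a b :=
    if a = b then 0
    else (if (a.val + 1) % n = b.val then 1 else 0) + (if (b.val + 1) % n = a.val then 1 else 0)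
  symm a b := by
    by_cases h : a = b
    · simp [h]
    · rw [if_neg h, if_neg (Ne.symm h), add_comm]
  loopless a := if_pos rfl

/-- `G` is the vertex-disjoint union of cycles, indexed by `ι`, the `i`-th of which has length
`c i ≥ 2`: the bijection `e` labels every vertex of `G` by the cycle it lies on and by its position
on that cycle. -/
def IsDisjointUnionOfCycles {V ι : Type*} (G : LooplessMultigraph V) (c : ι → ℕ) : Prop :=
  (∀ i, 2 ≤ c i) ∧
    ∃ e : (Σ i, Fin (c i)) ≃ V,
      (∀ (i : ι) (a b : Fin (c i)), G.mult (e ⟨i, a⟩) (e ⟨i, b⟩) = (cycle (c i)).mult a b) ∧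
      ∀ p q : Σ i, Fin (c i), p.1 ≠ q.1 → G.mult (e p) (e q) = 0

end LooplessMultigraph

/-- The number of blocks (with multiplicity) that contain both `x` and `y`. -/
def pairCount {V : Type*} [DecidableEq V] (blocks : Multiset (Finset V)) (x y : V) : ℕ :=
  Multiset.card (blocks.filter fun B => x ∈ B ∧ y ∈ B)

/-- `(V, blocks)` is a `(v, k, l)`-covering. Blocks form a collection, so that repeated blocks are
allowed. -/
structure IsCovering {V : Type*} [Fintype V] [DecidableEq V] (v k l : ℕ)
    (blocks : Multiset (Finset V)) : Prop where
  card_points : Fintype.card V = v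
  card_block : ∀ B ∈ blocks, B.card = k
  covers : ∀ x y : V, x ≠ y → l ≤ pairCount blocks x y

/-- A covering is symmetric if it has as many blocks as points. -/
structure IsSymmetricCovering {V : Type*} [Fintype V] [DecidableEq V] (v k l : ℕ)
    (blocks : Multiset (Finset V)) : Prop extends IsCovering v k l blocks where
  card_blocks : Multiset.card blocks = v

/-- The excess of a `(v, k, l)`-covering: the edge joining distinct points `x` and `y` has
multiplicity `r_xy - l`, where `r_xy` is the number of blocks containing both. (In a covering
`l ≤ r_xy`, so the subtraction does not truncate.) -/
def excess {V : Type*} [DecidableEq V] (l : ℕ) (blocks : Multiset (Finset V)) :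
    LooplessMultigraph V where
  mult x y := if x = y then 0 else pairCount blocks x y - l
  symm x y := by
    by_cases h : x = y
    · simp [h]
    · rw [if_neg h, if_neg (Ne.symm h)]
      simp only [pairCount, and_comm]
  loopless x := if_pos rfl

/-! The proof is a Bruck–Ryser type obstruction over `ℚ_[2]`. With `N` the incidence matrix and `A`
the adjacency matrix of the excess, `N Nᵗ = (k - 1) I + A + J`. Diagonalising `A` on each cycle and
splitting off `J` turns a covering into a linear map carrying ⟨1⟩ + t₂⟨2(k+1), 2(k-3)⟩ + t₃⟨3(k+1),
2(k-2), 6(k-2)⟩ into v⟨1⟩ + ⟨k+1⟩ (`represents_of_covering`).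

Four copies of ⟨n⟩ can be traded for 4⟨1⟩, and two copies for 2⟨1⟩ if n is a sum of two squares. As
t₃ ≡ 1 mod 4, Witt cancellation (`of_cons`) leaves ⟨3(k+1), 2(k-2), 6(k-2)⟩ represented by ⟨1, 1,
k+1⟩, or by ⟨2(k+1), 2(k+1), k+1⟩ when k ≡ 5 mod 8. The former is isotropic over `ℚ_[2]` and the
latter two are anisotropic, which `false_of_isotropic` excludes. Arbitrary linear maps suffice, so
neither invertibility of `N` nor Hasse invariants enter. -/

/-- Two finite families with the same multiset of values differ by a bijection of the indices. -/
theorem exists_equiv_of_map_univ_eq {ι κ α : Type*} [Fintype ι] [Fintype κ] {f : ι → α} {g : κ → α}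
    (h : Finset.univ.val.map f = Finset.univ.val.map g) : ∃ σ : ι ≃ κ, ∀ i, g (σ i) = f i := by
  classical
  have hcard (c : α) : Fintype.card {i // f i = c} = Fintype.card {j // g j = c} := by
    have := congrArg (Multiset.count c) h
    rw [Multiset.count_map, Multiset.count_map] at this
    rw [Fintype.card_subtype, Fintype.card_subtype, Finset.card_def, Finset.card_def,
      Finset.filter_val, Finset.filter_val]
    simpa only [eq_comm] using this
  exact ⟨Equiv.ofFiberEquiv fun c => Fintype.equivOfCardEq (hcard c),
    fun i => Equiv.ofFiberEquiv_map _ i⟩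

/-! ### Maps between diagonal forms and Witt cancellation -/

/-- There is a linear map that pulls the diagonal quadratic form with the coefficients `t` back to
the one with the coefficients `s`. -/
def Represents {K : Type*} [Field K] (s t : Multiset K) : Prop :=
  ∃ (m n : ℕ) (a : Fin m → K) (b : Fin n → K) (φ : (Fin m → K) →ₗ[K] (Fin n → K)),
    Finset.univ.val.map a = s ∧ Finset.univ.val.map b = t ∧
      ∀ x, ∑ j, b j * φ x j ^ 2 = ∑ i, a i * x i ^ 2

namespace Represents

variable {K : Type*} [Field K]

theorem exists_map_univ {α : Type*} (s : Multiset α) :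
    ∃ (n : ℕ) (a : Fin n → α), Finset.univ.val.map a = s := by
  induction s using Quotient.inductionOn with
  | h l => exact ⟨l.length, l.get, by simp⟩

theorem of_linearMap {ι κ : Type*} [Fintype ι] [Fintype κ] {a : ι → K} {b : κ → K}
    (φ : (ι → K) →ₗ[K] (κ → K)) (h : ∀ x, ∑ j, b j * φ x j ^ 2 = ∑ i, a i * x i ^ 2) :
    Represents (Finset.univ.val.map a) (Finset.univ.val.map b) := by
  obtain ⟨m, a', ha'⟩ := exists_map_univ (Finset.univ.val.map a)
  obtain ⟨n, b', hb'⟩ := exists_map_univ (Finset.univ.val.map b)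
  obtain ⟨σ, hσ⟩ := exists_equiv_of_map_univ_eq ha'
  obtain ⟨τ, hτ⟩ := exists_equiv_of_map_univ_eq hb'
  refine ⟨m, n, a', b', LinearMap.funLeft K K τ ∘ₗ φ ∘ₗ LinearMap.funLeft K K σ.symm, ha', hb',
    fun x => ?_⟩
  rw [← σ.symm.sum_comp, ← τ.symm.sum_comp]
  simp only [LinearMap.comp_apply, LinearMap.funLeft_apply, ← hσ, ← hτ, Equiv.apply_symm_apply]
  rw [h]
  rfl

theorem exists_linearMap {ι κ : Type*} [Fintype ι] [Fintype κ] {a : ι → K} {b : κ → K}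
    (h : Represents (Finset.univ.val.map a) (Finset.univ.val.map b)) :
    ∃ φ : (ι → K) →ₗ[K] (κ → K), ∀ x, ∑ j, b j * φ x j ^ 2 = ∑ i, a i * x i ^ 2 := by
  obtain ⟨m, n, a', b', φ, ha', hb', hφ⟩ := h
  obtain ⟨σ, hσ⟩ := exists_equiv_of_map_univ_eq ha'
  obtain ⟨τ, hτ⟩ := exists_equiv_of_map_univ_eq hb'
  refine ⟨LinearMap.funLeft K K τ.symm ∘ₗ φ ∘ₗ LinearMap.funLeft K K σ, fun x => ?_⟩
  rw [← σ.sum_comp, ← τ.sum_comp]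
  simp only [LinearMap.comp_apply, LinearMap.funLeft_apply, hσ, hτ, Equiv.symm_apply_apply]
  rw [hφ]
  rfl

theorem refl (s : Multiset K) : Represents s s := by
  obtain ⟨n, a, rfl⟩ := exists_map_univ s
  exact of_linearMap LinearMap.id fun _ => rfl

theorem trans {s t u : Multiset K} (h₁ : Represents s t) (h₂ : Represents t u) :
    Represents s u := by
  obtain ⟨m, a, rfl⟩ := exists_map_univ s
  obtain ⟨n, b, rfl⟩ := exists_map_univ t
  obtain ⟨l, c, rfl⟩ := exists_map_univ u
  obtain ⟨φ, hφ⟩ := h₁.exists_linearMap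
  obtain ⟨ψ, hψ⟩ := h₂.exists_linearMap
  exact of_linearMap (ψ ∘ₗ φ) fun x => (hψ _).trans (hφ x)

theorem map_univ_sumElim {α ι κ : Type*} [Fintype ι] [Fintype κ] (a : ι → α) (b : κ → α) :
    (Finset.univ : Finset (ι ⊕ κ)).val.map (Sum.elim a b) =
      Finset.univ.val.map a + Finset.univ.val.map b := by
  rw [← Finset.univ_disjSum_univ, Finset.val_disjSum, Multiset.map_disjSum]
  rfl

theorem map_univ_const {α : Type*} (ι : Type*) [Fintype ι] (c : α) :
    (Finset.univ : Finset ι).val.map (fun _ => c) = Fintype.card ι • {c} := by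
  rw [Multiset.map_const', Multiset.nsmul_singleton]
  rfl

theorem add {s t s' t' : Multiset K} (h : Represents s t) (h' : Represents s' t') :
    Represents (s + s') (t + t') := by
  obtain ⟨m, a, rfl⟩ := exists_map_univ s
  obtain ⟨n, b, rfl⟩ := exists_map_univ t
  obtain ⟨m', a', rfl⟩ := exists_map_univ s'
  obtain ⟨n', b', rfl⟩ := exists_map_univ t'
  obtain ⟨φ, hφ⟩ := h.exists_linearMap
  obtain ⟨ψ, hψ⟩ := h'.exists_linearMap
  rw [← map_univ_sumElim, ← map_univ_sumElim]
  refine of_linearMap (LinearMap.pi (Sum.elim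
    (fun j => LinearMap.proj j ∘ₗ φ ∘ₗ LinearMap.funLeft K K Sum.inl)
    (fun j => LinearMap.proj j ∘ₗ ψ ∘ₗ LinearMap.funLeft K K Sum.inr))) fun x => ?_
  simp only [Fintype.sum_sum_type, Sum.elim_inl, Sum.elim_inr, LinearMap.pi_apply,
    LinearMap.comp_apply, LinearMap.proj_apply, hφ, hψ, LinearMap.funLeft_apply]

theorem nsmul {s t : Multiset K} (h : Represents s t) (n : ℕ) : Represents (n • s) (n • t) := by
  induction n with
  | zero => simpa using refl 0
  | succ n ih => simpa only [succ_nsmul] using ih.add h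

/-- One-dimensional case of Witt's cancellation theorem. -/
theorem of_cons (h2 : (2 : K) ≠ 0) {c : K} {s t : Multiset K}
    (h : Represents ({c} + s) ({c} + t)) : Represents s t := by
  obtain ⟨m, a, rfl⟩ := exists_map_univ s
  obtain ⟨n, b, rfl⟩ := exists_map_univ t
  have hc : ({c} : Multiset K) = (Finset.univ : Finset Unit).val.map fun _ => c := rfl
  rw [hc, ← map_univ_sumElim, ← map_univ_sumElim] at h
  obtain ⟨φ, hφ⟩ := h.exists_linearMap
  set α := φ (Pi.single (Sum.inl ()) 1) (Sum.inl ()) with hα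
  -- The map `φ` is restricted to vectors `(l v, v)` whose image has first coordinate `ε * l v`;
  -- then the two terms `c * l v ^ 2` cancel. Solving for `l` requires `ε ≠ α`, and one of the signs
  -- `1`, `-1` achieves this.
  obtain ⟨ε, hε, hne⟩ : ∃ ε : K, ε ^ 2 = 1 ∧ ε - α ≠ 0 := by
    by_cases h1 : α = 1
    · exact ⟨-1, by ring, fun h => h2 (by linear_combination -h - h1)⟩
    · exact ⟨1, by ring, fun h => h1 (by linear_combination -h)⟩
  let emb : (Fin m → K) →ₗ[K] (Unit ⊕ Fin m → K) :=
    LinearMap.pi (Sum.elim (fun _ => 0) fun i => LinearMap.proj i)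
  let l : (Fin m → K) →ₗ[K] K := (ε - α)⁻¹ • (LinearMap.proj (Sum.inl ()) ∘ₗ φ ∘ₗ emb)
  let u : (Fin m → K) →ₗ[K] (Unit ⊕ Fin m → K) :=
    emb + l.smulRight (Pi.single (Sum.inl ()) 1)
  have hu1 (v) : u v (Sum.inl ()) = l v := by simp [u, emb]
  have hu2 (v i) : u v (Sum.inr i) = v i := by simp [u, emb]
  have hu3 (v) : φ (u v) (Sum.inl ()) = ε * l v := by
    have h1 : φ (u v) (Sum.inl ()) = φ (emb v) (Sum.inl ()) + l v * α := by
      simp [u, hα]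
    have h2 : l v * (ε - α) = φ (emb v) (Sum.inl ()) := by
      simp only [l, LinearMap.smul_apply, LinearMap.comp_apply, LinearMap.proj_apply, smul_eq_mul]
      field_simp
    rw [h1, ← h2]
    ring
  refine of_linearMap (LinearMap.funLeft K K Sum.inr ∘ₗ φ ∘ₗ u) fun v => ?_
  have := hφ (u v)
  simp only [Fintype.sum_sum_type, Finset.univ_unique, Finset.sum_singleton, Sum.elim_inl,
    Sum.elim_inr, PUnit.default_eq_unit, hu1, hu2, hu3] at this
  rw [mul_pow, hε, one_mul] at this
  exact add_left_cancel this

theorem of_add_left (h2 : (2 : K) ≠ 0) {r s t : Multiset K} (h : Represents (r + s) (r + t)) :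
    Represents s t := by
  induction r using Multiset.induction with
  | empty => simpa using h
  | cons c r ih =>
    refine ih (of_cons h2 (c := c) ?_)
    rwa [← Multiset.singleton_add, add_assoc, add_assoc] at h

/-- Multiplication by a complex number of norm `n`, divided by `n`. -/
theorem two_nsmul_one {n p q : K} (hn : n ≠ 0) (h : n = p ^ 2 + q ^ 2) :
    Represents (2 • {1}) (2 • {n}) := by
  have key := of_linearMap (K := K) (a := fun _ : Fin 2 => 1) (b := fun _ : Fin 2 => n)
    (Matrix.toLin' !![p / n, q / n; -q / n, p / n]) fun x => by
      simp only [Matrix.toLin'_apply, Matrix.mulVec, dotProduct, Fin.sum_univ_two, Matrix.of_apply,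
        Matrix.cons_val_zero, Matrix.cons_val_one, Matrix.cons_val_fin_one]
      field_simp
      rw [h]
      ring
  rwa [map_univ_const, map_univ_const, Fintype.card_fin] at key

/-- Lagrange's theorem gives a quaternion of norm `n`; the matrix is multiplication by it, divided
by `n`. -/
theorem four_nsmul_one [CharZero K] {n : ℕ} (hn : 0 < n) :
    Represents (4 • {1}) (4 • {(n : K)}) := by
  obtain ⟨a, b, c, d, h⟩ := Nat.sum_four_squares n
  have h' : (a : K) ^ 2 + (b : K) ^ 2 + (c : K) ^ 2 + (d : K) ^ 2 = n := by exact_mod_cast h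
  have hn' : (n : K) ≠ 0 := by exact_mod_cast hn.ne'
  have key := of_linearMap (K := K) (a := fun _ : Fin 4 => 1) (b := fun _ : Fin 4 => (n : K))
    (Matrix.toLin' !![a / n, b / n, c / n, d / n; -b / n, a / n, -d / n, c / n;
      -c / n, d / n, a / n, -b / n; -d / n, -c / n, b / n, a / n]) fun x => by
      simp only [Matrix.toLin'_apply, Matrix.mulVec, dotProduct, Fin.sum_univ_four,
        Matrix.of_apply, Matrix.cons_val]
      field_simp
      rw [← h']
      ring
  rwa [map_univ_const, map_univ_const, Fintype.card_fin] at key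

/-- A ternary form with an isotropic vector outside its radical is not represented by an
anisotropic ternary form. -/
theorem false_of_isotropic (h2 : (2 : K) ≠ 0) {a b c d e f : K}
    (h : Represents {a, b, c} {d, e, f}) (ha : a ≠ 0) {x y z : K}
    (hx : x ≠ 0) (hiso : a * x ^ 2 + b * y ^ 2 + c * z ^ 2 = 0)
    (hani : ∀ x y z : K, d * x ^ 2 + e * y ^ 2 + f * z ^ 2 = 0 → x = 0 ∧ y = 0 ∧ z = 0) :
    False := by
  have hs (a b c : K) : ({a, b, c} : Multiset K) = Finset.univ.val.map ![a, b, c] := rfl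
  rw [hs, hs] at h
  obtain ⟨φ, hφ⟩ := h.exists_linearMap
  simp only [Fin.sum_univ_three, Matrix.cons_val] at hφ
  have h0 : φ ![x, y, z] = 0 := by
    obtain ⟨h0, h1, h2⟩ := hani _ _ _ ((hφ ![x, y, z]).trans hiso)
    ext i
    fin_cases i <;> assumption
  -- The isotropic vector lies in the kernel of `φ`, hence in the radical; pairing it with the first
  -- basis vector gives `a * x = 0`.
  have h1 := hφ (![x, y, z] + ![1, 0, 0])
  rw [map_add, h0, zero_add, hφ] at h1
  simp only [Pi.add_apply, Matrix.cons_val] at h1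
  have h3 : 2 * (a * x) = 0 := by linear_combination -h1 - hiso
  exact mul_ne_zero h2 (mul_ne_zero ha hx) h3

end Represents

/-! ### Squares and ternary forms over the 2-adic numbers -/

namespace PadicTwo

/-- Hensel's lemma for `X ^ 2 - n` at `1`: the value has norm at most 1/8, below the squared norm
1/4 of the derivative. -/
theorem exists_sq_eq {n : ℤ} (h : n % 8 = 1) : ∃ s : ℚ_[2], s ^ 2 = n := by
  let F : Polynomial ℤ_[2] := Polynomial.X ^ 2 - Polynomial.C (n : ℤ_[2])
  have hF (x : ℤ_[2]) : Polynomial.aeval x F = x ^ 2 - n := by simp [F]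
  have hF' : Polynomial.aeval (1 : ℤ_[2]) (Polynomial.derivative F) = 2 := by
    simp [F, one_add_one_eq_two]
  have h2 : ‖(2 : ℤ_[2])‖ = 2⁻¹ := by simpa using PadicInt.norm_p (p := 2)
  have h8 : ‖((1 - n : ℤ) : ℤ_[2])‖ ≤ (2 : ℕ) ^ (-(3 : ℕ) : ℤ) :=
    PadicInt.norm_int_le_pow_iff_dvd.2 (by norm_num; omega)
  obtain ⟨z, hz, -⟩ := hensels_lemma (p := 2) (R := ℤ_[2]) (F := F) (a := 1) (by
    rw [hF, hF', h2, one_pow]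
    push_cast at h8
    refine h8.trans_lt ?_
    norm_num)
  rw [hF, sub_eq_zero] at hz
  exact ⟨z, by exact_mod_cast congrArg (fun w : ℤ_[2] => (w : ℚ_[2])) hz⟩

theorem exists_sq_add_sq_eq {n : ℤ} (h : n % 4 = 1) :
    ∃ p q : ℚ_[2], (n : ℚ_[2]) = p ^ 2 + q ^ 2 := by
  rcases (by omega : n % 8 = 1 ∨ (n - 4) % 8 = 1) with h | h
  · obtain ⟨s, hs⟩ := exists_sq_eq h
    exact ⟨s, 0, by rw [hs]; ring⟩
  · obtain ⟨s, hs⟩ := exists_sq_eq h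
    exact ⟨s, 2, by rw [hs]; push_cast; ring⟩

theorem exists_sq_add_sq_eq_two_mul {n : ℚ_[2]} (h : ∃ p q : ℚ_[2], n = p ^ 2 + q ^ 2) :
    ∃ p q : ℚ_[2], 2 * n = p ^ 2 + q ^ 2 := by
  obtain ⟨p, q, rfl⟩ := h
  exact ⟨p + q, p - q, by ring⟩

/-- A ternary form with odd leading coefficient that has a zero modulo `8` with first coordinate `1`
is isotropic. -/
theorem exists_isotropic {a b c : ℤ} (ha : a % 2 = 1)
    (h : ∃ x y : ZMod 8, (a : ZMod 8) + b * x ^ 2 + c * y ^ 2 = 0) :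
    ∃ x y z : ℚ_[2], x ≠ 0 ∧ a * x ^ 2 + b * y ^ 2 + c * z ^ 2 = 0 := by
  obtain ⟨x, y, h⟩ := h
  have h8 : (8 : ℤ) ∣ a + b * (x.val : ℤ) ^ 2 + c * (y.val : ℤ) ^ 2 := by
    rw [← Nat.cast_ofNat, ← ZMod.intCast_zmod_eq_zero_iff_dvd]
    push_cast
    simpa using h
  obtain ⟨m, hm⟩ := h8
  have ha2 : a * a % 8 = 1 := by
    rcases (by omega : a % 8 = 1 ∨ a % 8 = 3 ∨ a % 8 = 5 ∨ a % 8 = 7) with h | h | h | h <;>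
      simp [Int.mul_emod, h]
  -- Replacing `a` by `a - 8 * m` makes the zero modulo `8` exact; the factor `a` makes the number a
  -- square, as `a * a` is `1` modulo `8`.
  obtain ⟨s, hs⟩ := exists_sq_eq (n := a * (a - 8 * m)) (by
    rw [mul_sub, show a * (8 * m) = 8 * (a * m) by ring]
    omega)
  have hm' : (a : ℚ_[2]) + b * (x.val : ℚ_[2]) ^ 2 + c * (y.val : ℚ_[2]) ^ 2 = 8 * m := by
    exact_mod_cast congrArg (Int.cast : ℤ → ℚ_[2]) hm
  have ha0 : (a : ℚ_[2]) ≠ 0 := by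
    have : a ≠ 0 := by rintro rfl; simp at ha
    exact_mod_cast this
  refine ⟨s, a * x.val, a * y.val, ?_, ?_⟩
  · rintro rfl
    have h0 : a * (a - 8 * m) = 0 := by
      have : ((a * (a - 8 * m) : ℤ) : ℚ_[2]) = 0 := by rw [← hs]; ring
      exact_mod_cast this
    rw [mul_sub, show a * (8 * m) = 8 * (a * m) by ring] at h0
    omega
  · rw [hs]
    push_cast
    linear_combination (a : ℚ_[2]) ^ 2 * hm'

/-- Dividing a nonzero zero by a coordinate of largest norm gives an integral zero with a coordinate
`1`, which stays a unit modulo `8`. -/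
theorem anisotropic {a b c : ℤ}
    (h : ∀ x y z : ZMod 8, (a : ZMod 8) * x ^ 2 + b * y ^ 2 + c * z ^ 2 = 0 →
      ¬ IsUnit x ∧ ¬ IsUnit y ∧ ¬ IsUnit z) (x y z : ℚ_[2])
    (h0 : a * x ^ 2 + b * y ^ 2 + c * z ^ 2 = 0) : x = 0 ∧ y = 0 ∧ z = 0 := by
  by_contra hne
  obtain ⟨w, hw, hw0, hx, hy, hz⟩ : ∃ w, (w = x ∨ w = y ∨ w = z) ∧ w ≠ 0 ∧
      ‖x‖ ≤ ‖w‖ ∧ ‖y‖ ≤ ‖w‖ ∧ ‖z‖ ≤ ‖w‖ := by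
    obtain ⟨i, -, hi⟩ := Finset.exists_max_image (Finset.univ : Finset (Fin 3))
      (fun i => ‖![x, y, z] i‖) Finset.univ_nonempty
    have h1 := hi 0 (Finset.mem_univ _)
    have h2 := hi 1 (Finset.mem_univ _)
    have h3 := hi 2 (Finset.mem_univ _)
    refine ⟨![x, y, z] i, by fin_cases i <;> simp, fun hw => hne ?_, h1, h2, h3⟩
    simp only [hw, norm_zero, norm_le_zero_iff] at h1 h2 h3
    exact ⟨h1, h2, h3⟩
  have hle {t : ℚ_[2]} (ht : ‖t‖ ≤ ‖w‖) : ‖t / w‖ ≤ 1 := by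
    rw [norm_div]
    exact div_le_one_of_le₀ ht (norm_nonneg _)
  let X : ℤ_[2] := ⟨x / w, hle hx⟩
  let Y : ℤ_[2] := ⟨y / w, hle hy⟩
  let Z : ℤ_[2] := ⟨z / w, hle hz⟩
  have hXYZ : (a : ℤ_[2]) * X ^ 2 + b * Y ^ 2 + c * Z ^ 2 = 0 := by
    apply Subtype.ext
    push_cast
    change (a : ℚ_[2]) * (x / w) ^ 2 + b * (y / w) ^ 2 + c * (z / w) ^ 2 = 0
    field_simp
    rw [h0, mul_zero]
  have h8 := congrArg (PadicInt.toZModPow (p := 2) 3) hXYZ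
  simp only [map_add, map_mul, map_pow, map_intCast, map_zero] at h8
  obtain ⟨h1, h2, h3⟩ := h _ _ _ h8
  have hunit {T : ℤ_[2]} (hT : (T : ℚ_[2]) = w / w) :
      IsUnit (PadicInt.toZModPow (p := 2) 3 T) := by
    rw [show T = 1 from Subtype.ext (hT.trans (div_self hw0)), map_one]
    exact isUnit_one
  rcases hw with hw | hw | hw
  · exact h1 (hunit (congrArg (· / w) hw.symm))
  · exact h2 (hunit (congrArg (· / w) hw.symm))
  · exact h3 (hunit (congrArg (· / w) hw.symm))

theorem anisotropic_one_one {d : ℤ} (hd : d % 4 = 1) (x y z : ℚ_[2])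
    (h : 1 * x ^ 2 + 1 * y ^ 2 + d * z ^ 2 = 0) : x = 0 ∧ y = 0 ∧ z = 0 := by
  refine anisotropic (a := 1) (b := 1) (c := d) ?_ x y z (by exact_mod_cast h)
  have h8 : (d : ZMod 8) = 1 ∨ (d : ZMod 8) = 5 := by
    rcases (by omega : d % 8 = 1 ∨ d % 8 = 5) with h | h
    · exact .inl ((ZMod.intCast_eq_intCast_iff' d 1 8).2 h)
    · exact .inr ((ZMod.intCast_eq_intCast_iff' d 5 8).2 h)
  rcases h8 with h | h <;> rw [h] <;> decide +revert

theorem anisotropic_one_one_two_mul {d : ℤ} (hd : d % 4 = 1) (x y z : ℚ_[2])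
    (h : 1 * x ^ 2 + 1 * y ^ 2 + (2 * d : ℤ) * z ^ 2 = 0) : x = 0 ∧ y = 0 ∧ z = 0 := by
  refine anisotropic (a := 1) (b := 1) (c := 2 * d) ?_ x y z (by exact_mod_cast h)
  have h8 : ((2 * d : ℤ) : ZMod 8) = 2 :=
    (ZMod.intCast_eq_intCast_iff' (2 * d) 2 8).2 (by omega)
  rw [h8]
  decide +revert

end PadicTwo

/-! ### The Gram form of a covering -/

theorem pairCount_cons {V : Type*} [DecidableEq V] (B : Finset V) (s : Multiset (Finset V))
    (x y : V) : pairCount (B ::ₘ s) x y = (if x ∈ B ∧ y ∈ B then 1 else 0) + pairCount s x y := by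
  unfold pairCount
  split_ifs with h
  · rw [Multiset.filter_cons_of_pos (p := fun B => x ∈ B ∧ y ∈ B) _ h, Multiset.card_cons, add_comm]
  · rw [Multiset.filter_cons_of_neg (p := fun B => x ∈ B ∧ y ∈ B) _ h, zero_add]

theorem sum_pairCount {V : Type*} [Fintype V] [DecidableEq V] {k : ℕ} (s : Multiset (Finset V))
    (hs : ∀ B ∈ s, B.card = k) (x : V) : ∑ y, pairCount s x y = pairCount s x x * k := by
  induction s using Multiset.induction with
  | empty => simp [pairCount]
  | cons B s ih =>
    rw [Multiset.forall_mem_cons] at hs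
    simp only [pairCount_cons, Finset.sum_add_distrib, ih hs.2, add_mul, and_self]
    by_cases hx : x ∈ B <;> simp [hx, hs.1]

theorem sum_sq_sum_block {V R : Type*} [Fintype V] [DecidableEq V] [CommRing R]
    (s : Multiset (Finset V)) (w : V → R) :
    (s.map fun B => (∑ x ∈ B, w x) ^ 2).sum = ∑ x, ∑ y, pairCount s x y * (w x * w y) := by
  induction s using Multiset.induction with
  | empty => simp [pairCount]
  | cons B s ih =>
    simp only [Multiset.map_cons, Multiset.sum_cons, ih, pairCount_cons, Nat.cast_add, add_mul,
      Finset.sum_add_distrib, Nat.cast_ite, Nat.cast_one, Nat.cast_zero, ite_mul, one_mul, zero_mul]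
    congr 1
    have h (x : V) : (∑ y, if x ∈ B ∧ y ∈ B then w x * w y else 0) =
        if x ∈ B then ∑ y ∈ B, w x * w y else 0 := by
      by_cases hx : x ∈ B <;> simp [hx]
    simp only [h, Finset.sum_ite_mem, Finset.univ_inter]
    rw [sq, Finset.sum_mul_sum]

theorem sum_mult_sub {V R : Type*} [Fintype V] [CommRing R] (G : LooplessMultigraph V) {d : ℕ}
    (hdeg : ∀ x, ∑ y, G.mult x y = d) (w : V → R) (c : R) :
    ∑ x, ∑ y, (G.mult x y : R) * ((w x - c) * (w y - c)) =
      ∑ x, ∑ y, (G.mult x y : R) * (w x * w y) - 2 * d * c * ∑ x, w x +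
        d * Fintype.card V * c ^ 2 := by
  have hd (x) : ∑ y, (G.mult x y : R) = d := by exact_mod_cast congrArg (Nat.cast : ℕ → R) (hdeg x)
  have hd' (y) : ∑ x, (G.mult x y : R) = d := by simpa only [G.symm y] using hd y
  have h1 : ∑ x, ∑ y, (G.mult x y : R) * w x = d * ∑ x, w x := by
    simp only [← Finset.sum_mul, hd, Finset.mul_sum]
  have h2 : ∑ x, ∑ y, (G.mult x y : R) * w y = d * ∑ x, w x := by
    rw [Finset.sum_comm]
    simp only [← Finset.sum_mul, hd', Finset.mul_sum]
  have h3 : ∑ x, ∑ y, (G.mult x y : R) = d * Fintype.card V := by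
    simp [hd, mul_comm]
  have h4 (x y : V) : (G.mult x y : R) * ((w x - c) * (w y - c)) =
      G.mult x y * (w x * w y) - c * (G.mult x y * w x) - c * (G.mult x y * w y) +
        c ^ 2 * G.mult x y := by ring
  simp only [h4, Finset.sum_add_distrib, Finset.sum_sub_distrib, ← Finset.mul_sum, h1, h2, h3]
  ring

section Regular

variable {V : Type*} [Fintype V] [DecidableEq V] {v k : ℕ} {blocks : Multiset (Finset V)}

theorem IsCovering.pairCount_eq (h : IsCovering v k 1 blocks) {x y : V} (hxy : x ≠ y) :
    pairCount blocks x y = 1 + (excess 1 blocks).mult x y := by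
  have := h.covers x y hxy
  simp only [excess, if_neg hxy]
  omega

/-- Counting the pairs (y, B) with x, y ∈ B gives r k = r + (v - 1) + 2 = r + k (k - 1) for the
replication number r of x. -/
theorem IsCovering.pairCount_self (h : IsCovering v k 1 blocks) (hk : 1 < k)
    (hv : v + 1 = k * (k - 1)) (hdeg : ∀ x, ∑ y, (excess 1 blocks).mult x y = 2) (x : V) :
    pairCount blocks x x = k := by
  have h1 := sum_pairCount blocks h.card_block x
  rw [← Finset.add_sum_erase _ _ (Finset.mem_univ x),
    Finset.sum_congr rfl fun y hy => h.pairCount_eq (Finset.ne_of_mem_erase hy).symm,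
    Finset.sum_add_distrib, Finset.sum_erase _ ((excess 1 blocks).loopless x), hdeg] at h1
  rw [Finset.sum_const, Finset.card_erase_of_mem (Finset.mem_univ x), Finset.card_univ,
    h.card_points] at h1
  obtain ⟨k, rfl⟩ := Nat.exists_eq_add_of_lt hk
  have hv0 : 0 < v := h.card_points ▸ Fintype.card_pos_iff.2 ⟨x⟩
  have h2 : (v - 1) • 1 + 2 = v + 1 := by rw [smul_eq_mul]; omega
  rw [h2, hv] at h1
  simp only [Nat.add_sub_cancel] at h1
  have h3 : pairCount blocks x x * (1 + k) = (1 + k + 1) * (1 + k) := by linarith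
  exact Nat.eq_of_mul_eq_mul_right (by omega) h3

theorem IsCovering.sum_sq_sum_block {R : Type*} [CommRing R] (h : IsCovering v k 1 blocks)
    (hk : 1 < k) (hv : v + 1 = k * (k - 1)) (hdeg : ∀ x, ∑ y, (excess 1 blocks).mult x y = 2)
    (w : V → R) :
    (blocks.map fun B => (∑ x ∈ B, w x) ^ 2).sum = (k - 1) * ∑ x, w x ^ 2 +
      ∑ x, ∑ y, (excess 1 blocks).mult x y * (w x * w y) + (∑ x, w x) ^ 2 := by
  have key (x y : V) : (pairCount blocks x y : R) =
      (if x = y then (k : R) - 1 else 0) + (excess 1 blocks).mult x y + 1 := by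
    by_cases hxy : x = y
    · subst hxy
      rw [h.pairCount_self hk hv hdeg, (excess 1 blocks).loopless]
      simp
    · rw [h.pairCount_eq hxy, if_neg hxy]
      push_cast
      ring
  rw [_root_.sum_sq_sum_block]
  simp only [key, add_mul, Finset.sum_add_distrib, one_mul]
  congr 2
  · simp [Finset.mul_sum, sq]
  · rw [sq, Finset.sum_mul_sum]

/-- The Gram form of a symmetric covering with `2`-regular excess, diagonalised along the all-one
vector. -/
theorem IsCovering.sum_sq_sum_block_sub {K : Type*} [Field K] [CharZero K]
    (h : IsCovering v k 1 blocks)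
    (hk : 1 < k) (hv : v + 1 = k * (k - 1)) (hdeg : ∀ x, ∑ y, (excess 1 blocks).mult x y = 2)
    (w : V → K) {y z : K} (hz : k * z = ∑ x, w x - y) :
    (blocks.map fun B => (∑ x ∈ B, (w x - z / k)) ^ 2).sum + (k + 1) * z ^ 2 =
      (k - 1) * ∑ x, w x ^ 2 + ∑ x, ∑ y, (excess 1 blocks).mult x y * (w x * w y) + y ^ 2 := by
  have hk0 : (k : K) ≠ 0 := by exact_mod_cast (by omega : k ≠ 0)
  have hvK : (v : K) = k * (k - 1) - 1 := by
    rw [eq_sub_iff_add_eq, ← Nat.cast_one, ← Nat.cast_sub hk.le]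
    exact_mod_cast hv
  -- The all-one vector is an eigenvector of `(k - 1) I + A + J` with eigenvalue k - 1 + 2 + v = k².
  -- The shift by `z / k` thus adds -2kz∑w + v z², and v + (k + 1) = k² completes the square.
  obtain rfl : y = ∑ x, w x - k * z := by rw [hz]; ring
  have h1 : ∑ x, (w x - z / k) ^ 2 = ∑ x, w x ^ 2 - 2 * (z / k) * ∑ x, w x + v * (z / k) ^ 2 := by
    simp only [sub_sq, Finset.sum_add_distrib, Finset.sum_sub_distrib, Finset.sum_const,
      Finset.card_univ, h.card_points, nsmul_eq_mul, Finset.mul_sum]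
    congr 2
    exact Finset.sum_congr rfl fun x _ => by ring
  have h2 : ∑ x, (w x - z / k) = ∑ x, w x - v * (z / k) := by
    simp [h.card_points]
  rw [h.sum_sq_sum_block hk hv hdeg, h1, h2, sum_mult_sub _ hdeg, h.card_points, hvK]
  field_simp
  push_cast
  ring

end Regular

/-! ### Diagonalising the excess along its cycles -/

namespace LooplessMultigraph

theorem sum_mult_disjointUnion {V ι R : Type*} [Fintype V] [Fintype ι] [DecidableEq ι]
    [CommSemiring R]
    {G : LooplessMultigraph V} {c : ι → ℕ} (e : (Σ i, Fin (c i)) ≃ V)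
    (he : ∀ (i : ι) (a b : Fin (c i)), G.mult (e ⟨i, a⟩) (e ⟨i, b⟩) = (cycle (c i)).mult a b)
    (he' : ∀ p q : Σ i, Fin (c i), p.1 ≠ q.1 → G.mult (e p) (e q) = 0) (i : ι) (a : Fin (c i))
    (f : V → R) :
    ∑ y, (G.mult (e ⟨i, a⟩) y : R) * f y =
      ∑ b, ((cycle (c i)).mult a b : R) * f (e ⟨i, b⟩) := by
  rw [← e.sum_comp, Fintype.sum_sigma, Finset.sum_eq_single i]
  · simp only [he]
  · intro j _ hj
    exact Finset.sum_eq_zero fun b _ => by rw [he' _ _ hj.symm, Nat.cast_zero, zero_mul]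
  · simp

theorem sum_cycle_two (a : Fin 2) : ∑ b, (cycle 2).mult a b = 2 := by
  decide +revert

theorem sum_cycle_three (a : Fin 3) : ∑ b, (cycle 3).mult a b = 2 := by
  decide +revert

end LooplessMultigraph

theorem represents_of_covering {K : Type*} [Field K] [CharZero K] {t₂ t₃ v k : ℕ} (hk : 1 < k)
    (hv : v + 1 = k * (k - 1)) {V : Type*} [Fintype V] [DecidableEq V]
    {blocks : Multiset (Finset V)} (h : IsSymmetricCovering v k 1 blocks)
    (hG : (excess 1 blocks).IsDisjointUnionOfCycles
      (Sum.elim (fun _ : Fin t₂ => 2) (fun _ : Fin t₃ => 3))) :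
    Represents (({1} + (t₂ • {2 * ((k : K) + 1)} + t₂ • {2 * ((k : K) - 3)})) +
      (t₃ • {3 * ((k : K) + 1)} + (t₃ • {2 * ((k : K) - 2)} + t₃ • {6 * ((k : K) - 2)})))
      (v • {1} + {(k : K) + 1}) := by
  obtain ⟨-, e, he, he'⟩ := hG
  have hsum := LooplessMultigraph.sum_mult_disjointUnion (R := K) e he he'
  have hdeg (x : V) : ∑ y, (excess 1 blocks).mult x y = 2 := by
    obtain ⟨⟨i, a⟩, rfl⟩ := e.surjective x
    have h2 := LooplessMultigraph.sum_mult_disjointUnion (R := ℕ) e he he' i a fun _ => 1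
    simp only [mul_one, Nat.cast_id] at h2
    rw [h2]
    match i with
    | .inl i => exact LooplessMultigraph.sum_cycle_two a
    | .inr i => exact LooplessMultigraph.sum_cycle_three a
  obtain ⟨n, b, rfl⟩ := Represents.exists_map_univ blocks
  obtain rfl : n = v := by simpa using h.card_blocks
  let ι := (Unit ⊕ (Fin t₂ ⊕ Fin t₂)) ⊕ (Fin t₃ ⊕ (Fin t₃ ⊕ Fin t₃))
  let P (j : ι) : (ι → K) →ₗ[K] K := LinearMap.proj j
  let S (j : Fin t₂) := P (.inl (.inr (.inl j)))
  let D (j : Fin t₂) := P (.inl (.inr (.inr j)))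
  let S' (j : Fin t₃) := P (.inr (.inl j))
  let D' (j : Fin t₃) := P (.inr (.inr (.inl j)))
  let E' (j : Fin t₃) := P (.inr (.inr (.inr j)))
  -- Coordinates along orthogonal eigenvectors of `A`: (1,1), (1,-1) on a 2-cycle, with eigenvalues
  -- 2, -2; (1,1,1), (1,-1,0), (1,1,-2) on a 3-cycle, with eigenvalues 2, -1, -1.
  let W' (i : Fin t₂ ⊕ Fin t₃) :
      Fin (Sum.elim (fun _ : Fin t₂ => 2) (fun _ : Fin t₃ => 3) i) → (ι → K) →ₗ[K] K :=
    match i with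
    | .inl j => ![S j + D j, S j - D j]
    | .inr j => ![S' j + D' j + E' j, S' j - D' j + E' j, S' j - (2 : K) • E' j]
  let W (x : V) : (ι → K) →ₗ[K] K := W' (e.symm x).1 (e.symm x).2
  let Z : (ι → K) →ₗ[K] K := (k : K)⁻¹ • (∑ x, W x - P (.inl (.inl ())))
  let φ : (ι → K) →ₗ[K] (Fin n ⊕ Unit → K) := LinearMap.pi
    (Sum.elim (fun i => ∑ x ∈ b i, (W x - (k : K)⁻¹ • Z)) fun _ => Z)
  have key := Represents.of_linearMap (K := K)
    (a := Sum.elim (Sum.elim (fun _ : Unit => 1)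
        (Sum.elim (fun _ : Fin t₂ => 2 * ((k : K) + 1)) (fun _ : Fin t₂ => 2 * ((k : K) - 3))))
      (Sum.elim (fun _ : Fin t₃ => 3 * ((k : K) + 1))
        (Sum.elim (fun _ : Fin t₃ => 2 * ((k : K) - 2)) (fun _ : Fin t₃ => 6 * ((k : K) - 2)))))
    (b := Sum.elim (fun _ : Fin n => 1) (fun _ : Unit => (k : K) + 1)) φ fun x => by
      have hk0 : (k : K) ≠ 0 := by exact_mod_cast (by omega : k ≠ 0)
      have hZ : k * Z x = ∑ y, W y x - x (.inl (.inl ())) := by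
        simp only [Z, LinearMap.smul_apply, LinearMap.sub_apply, LinearMap.sum_apply, smul_eq_mul]
        rw [mul_inv_cancel_left₀ hk0]
        rfl
      have h1 := h.toIsCovering.sum_sq_sum_block_sub hk hv hdeg (fun y => W y x) hZ
      have hW (p) : W (e p) = W' p.1 p.2 := by
        simp only [W]
        rw [e.symm_apply_apply]
      have h2 (i) (a : Fin (Sum.elim (fun _ : Fin t₂ => 2) (fun _ : Fin t₃ => 3) i)) :
          ∑ y, ((excess 1 (Finset.univ.val.map b)).mult (e ⟨i, a⟩) y : K) *
              (W (e ⟨i, a⟩) x * W y x) =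
            ∑ b, ((LooplessMultigraph.cycle _).mult a b : K) * (W' i a x * W' i b x) := by
        rw [hsum i a fun y => W (e ⟨i, a⟩) x * W y x]
        simp only [hW]
      have h3 (j : Fin t₂) : ((k : K) - 1) * ∑ a, W' (.inl j) a x ^ 2 + ∑ a, ∑ b,
          ((LooplessMultigraph.cycle _).mult a b : K) * (W' (.inl j) a x * W' (.inl j) b x) =
            2 * ((k : K) + 1) * S j x ^ 2 + 2 * ((k : K) - 3) * D j x ^ 2 := by
        change ((k : K) - 1) * ∑ a : Fin 2, _ + ∑ a : Fin 2, ∑ b : Fin 2, _ = _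
        simp only [Fin.sum_univ_two]
        simp [LooplessMultigraph.cycle, W']
        ring
      have h4 (j : Fin t₃) : ((k : K) - 1) * ∑ a, W' (.inr j) a x ^ 2 + ∑ a, ∑ b,
          ((LooplessMultigraph.cycle _).mult a b : K) * (W' (.inr j) a x * W' (.inr j) b x) =
            3 * ((k : K) + 1) * S' j x ^ 2 + 2 * ((k : K) - 2) * D' j x ^ 2 +
              6 * ((k : K) - 2) * E' j x ^ 2 := by
        change ((k : K) - 1) * ∑ a : Fin 3, _ + ∑ a : Fin 3, ∑ b : Fin 3, _ = _
        simp only [Fin.sum_univ_three]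
        simp [LooplessMultigraph.cycle, W']
        ring
      have h6 : ∑ y, W y x ^ 2 = ∑ i, ∑ a, W' i a x ^ 2 := by
        rw [← e.sum_comp, Fintype.sum_sigma]
        simp only [hW]
      have h7 : ∑ z, ∑ y, ((excess 1 (Finset.univ.val.map b)).mult z y : K) * (W z x * W y x) =
          ∑ i, ∑ a, ∑ c, ((LooplessMultigraph.cycle _).mult a c : K) *
            (W' i a x * W' i c x) := by
        rw [← e.sum_comp, Fintype.sum_sigma]
        simp only [h2]
      rw [h6, h7, Finset.mul_sum, ← Finset.sum_add_distrib, Fintype.sum_sum_type,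
        Finset.sum_congr rfl fun j _ => h3 j, Finset.sum_congr rfl fun j _ => h4 j,
        Finset.sum_add_distrib, Finset.sum_add_distrib, Finset.sum_add_distrib,
        Multiset.map_map] at h1
      simp only [Fintype.sum_sum_type, Sum.elim_inl, Sum.elim_inr, Finset.univ_unique,
        Finset.sum_singleton, one_mul]
      have h5 : ∑ i, φ x (.inl i) ^ 2 =
          (Multiset.map ((fun B => (∑ y ∈ B, (W y x - Z x / k)) ^ 2) ∘ b) Finset.univ.val).sum := by
        refine Finset.sum_congr rfl fun i _ => ?_
        simp [φ, div_eq_inv_mul]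
      rw [h5]
      refine h1.trans ?_
      simp only [S, D, S', D', E', P, LinearMap.proj_apply]
      ring
  simp only [Represents.map_univ_sumElim, Represents.map_univ_const, Fintype.card_fin,
    Fintype.card_unit, one_smul] at key
  exact key

/-! ### Reduction to ternary forms and the contradiction -/

namespace Represents

variable {K : Type*} [Field K]

theorem four_mul_nsmul_add [CharZero K] {c : K} {n : ℕ} (hn : 0 < n) (hc : (n : K) = c)
    (q r : ℕ) : Represents ((4 * q) • {1} + r • {c}) ((4 * q + r) • {c}) := by
  subst hc
  rw [add_nsmul, mul_nsmul, mul_nsmul]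
  exact (four_nsmul_one hn).nsmul q |>.add (refl _)

theorem two_mul_nsmul {c : K} (hc : c ≠ 0) (h : ∃ x y : K, c = x ^ 2 + y ^ 2) (p : ℕ) :
    Represents ((2 * p) • {1}) ((2 * p) • {c}) := by
  obtain ⟨x, y, h⟩ := h
  rw [mul_nsmul, mul_nsmul]
  exact (two_nsmul_one hc h).nsmul p

end Represents

/-- With t₃ = 4q + 1, all but one 3-cycle contribute 12q ones. The summand `s` holds whatever part
of the 2-cycle contribution is not turned into ones; it cancels too. -/
theorem represents_ternary_of_covering {K : Type*} [Field K] [CharZero K] {t₂ q k m : ℕ}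
    {V : Type*} [Fintype V] [DecidableEq V] {blocks : Multiset (Finset V)} (hk : 3 < k)
    (hv : 2 * t₂ + 3 * (4 * q + 1) + 1 = k * (k - 1))
    (h : IsSymmetricCovering (2 * t₂ + 3 * (4 * q + 1)) k 1 blocks)
    (hG : (excess 1 blocks).IsDisjointUnionOfCycles
      (Sum.elim (fun _ : Fin t₂ => 2) (fun _ : Fin (4 * q + 1) => 3)))
    {s t : Multiset K}
    (hs : Represents (m • {1} + s) (t₂ • {2 * ((k : K) + 1)} + t₂ • {2 * ((k : K) - 3)}))
    (ht : Represents ((2 * t₂ + 3 * (4 * q + 1)) • {1}) ((m + 12 * q + 1) • {1} + s + t)) :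
    Represents {3 * ((k : K) + 1), 2 * ((k : K) - 2), 6 * ((k : K) - 2)} (t + {(k : K) + 1}) := by
  have h1 := represents_of_covering (K := K) (by omega) hv h hG
  have h2 : ((k - 2 : ℕ) : K) = k - 2 := by rw [Nat.cast_sub (by omega), Nat.cast_ofNat]
  have hC := Represents.four_mul_nsmul_add (K := K) (n := 3 * (k + 1)) (by omega)
    (by push_cast; rfl) q 1
  have hD := Represents.four_mul_nsmul_add (K := K) (n := 2 * (k - 2)) (by omega)
    (by rw [Nat.cast_mul, h2, Nat.cast_ofNat]) q 1
  have hE := Represents.four_mul_nsmul_add (K := K) (n := 6 * (k - 2)) (by omega)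
    (by rw [Nat.cast_mul, h2, Nat.cast_ofNat]) q 1
  have h3 := ((((Represents.refl {1}).add hs).add (hC.add (hD.add hE))).trans h1).trans
    (ht.add (Represents.refl _))
  refine Represents.of_add_left two_ne_zero (r := (m + 12 * q + 1) • {1} + s) ?_
  convert h3 using 1
  · simp only [Multiset.insert_eq_cons, ← Multiset.singleton_add]
    module
  · simp only [add_assoc]

/-- The ternary form with the coefficients `3 (k + 1)`, `2 (k - 2)`, `6 (k - 2)`
is isotropic over `ℚ₂`. -/
theorem PadicTwo.exists_isotropic_ternary {k : ℤ} (hk : k % 4 = 0 ∨ k % 4 = 1) :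
    ∃ x y z : ℚ_[2], x ≠ 0 ∧ 3 * ((k : ℚ_[2]) + 1) * x ^ 2 + 2 * ((k : ℚ_[2]) - 2) * y ^ 2 +
      6 * ((k : ℚ_[2]) - 2) * z ^ 2 = 0 := by
  rcases hk with hk | hk
  · obtain ⟨r, rfl⟩ := Int.dvd_of_emod_eq_zero hk
    have hdec : ∀ r : ZMod 8, ∃ x y : ZMod 8,
        3 * (4 * r + 1) + (2 * r - 1) * x ^ 2 + 3 * (2 * r - 1) * y ^ 2 = 0 := by decide
    obtain ⟨x, y, z, hx, h⟩ := exists_isotropic (a := 3 * (4 * r + 1)) (b := 2 * r - 1)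
      (c := 3 * (2 * r - 1)) (by omega) (by push_cast; exact hdec r)
    -- For k = 4r the last two coefficients are 4(2r - 1) and 12(2r - 1); doubling `x` matches the
    -- square factor 4.
    refine ⟨2 * x, y, z, mul_ne_zero two_ne_zero hx, ?_⟩
    push_cast at h ⊢
    linear_combination 4 * h
  · obtain ⟨j, rfl⟩ : ∃ j, k = 4 * j + 1 := ⟨k / 4, by omega⟩
    have hdec : ∀ j : ZMod 8, ∃ x y : ZMod 8,
        3 * (2 * j + 1) + (4 * j - 1) * x ^ 2 + 3 * (4 * j - 1) * y ^ 2 = 0 := by decide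
    obtain ⟨x, y, z, hx, h⟩ := exists_isotropic (a := 3 * (2 * j + 1)) (b := 4 * j - 1)
      (c := 3 * (4 * j - 1)) (by omega) (by push_cast; exact hdec j)
    refine ⟨x, y, z, hx, ?_⟩
    push_cast at h ⊢
    linear_combination 2 * h

theorem false_of_represents_ternary {k : ℕ} {d e : ℚ_[2]} (hk : k % 4 = 0 ∨ k % 4 = 1)
    (h : Represents {3 * ((k : ℚ_[2]) + 1), 2 * ((k : ℚ_[2]) - 2), 6 * ((k : ℚ_[2]) - 2)}
      ({d} + {e} + {(k : ℚ_[2]) + 1}))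
    (hani : ∀ x y z : ℚ_[2], d * x ^ 2 + e * y ^ 2 + ((k : ℚ_[2]) + 1) * z ^ 2 = 0 →
      x = 0 ∧ y = 0 ∧ z = 0) : False := by
  obtain ⟨x, y, z, hx, hiso⟩ := PadicTwo.exists_isotropic_ternary (k := k) (by omega)
  rw [Int.cast_natCast] at hiso
  refine Represents.false_of_isotropic two_ne_zero (a := 3 * ((k : ℚ_[2]) + 1)) h ?_ hx hiso hani
  exact mul_ne_zero three_ne_zero (Nat.cast_add_one_ne_zero k)

theorem mainTheorem6 (t₂ t₃ k : ℕ) (ht₂ : 0 < t₂) (ht₃ : 0 < t₃) (hk : 3 < k)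
    (hv : 2 * t₂ + 3 * t₃ = k * (k - 1) - 1)
    (h : (k ≡ 0 [MOD 4] ∧ t₃ ≡ 1 [MOD 4]) ∨ (k ≡ 1 [MOD 4] ∧ t₃ ≡ 5 [MOD 8]))
    {V : Type*} [Fintype V] [DecidableEq V] :
    ¬ ∃ blocks : Multiset (Finset V),
        IsSymmetricCovering (2 * t₂ + 3 * t₃) k 1 blocks ∧
        (excess 1 blocks).IsDisjointUnionOfCycles
          (Sum.elim (fun _ : Fin t₂ => 2) (fun _ : Fin t₃ => 3)) := by
  rintro ⟨blocks, hcov, hG⟩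
  simp only [Nat.ModEq] at h
  obtain ⟨q, rfl⟩ : ∃ q, t₃ = 4 * q + 1 := ⟨t₃ / 4, by omega⟩
  have hv' : 2 * t₂ + 3 * (4 * q + 1) + 1 = k * (k - 1) := by omega
  have h3 : ((k : ℚ_[2]) - 3) = ((k - 3 : ℕ) : ℚ_[2]) := by
    rw [Nat.cast_sub (by omega), Nat.cast_ofNat]
  have hA0 : 2 * ((k : ℚ_[2]) + 1) ≠ 0 := mul_ne_zero two_ne_zero (Nat.cast_add_one_ne_zero k)
  have hB0 : 2 * ((k : ℚ_[2]) - 3) ≠ 0 := by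
    rw [h3]
    exact mul_ne_zero two_ne_zero (Nat.cast_ne_zero.2 (by omega))
  have key {m : ℕ} {s : Multiset ℚ_[2]} {d e : ℚ_[2]}
      (hs : Represents (m • {1} + s)
        (t₂ • {2 * ((k : ℚ_[2]) + 1)} + t₂ • {2 * ((k : ℚ_[2]) - 3)}))
      (ht : Represents ((2 * t₂ + 3 * (4 * q + 1)) • {1})
        ((m + 12 * q + 1) • {1} + s + ({d} + {e})))
      (hani : ∀ x y z : ℚ_[2], d * x ^ 2 + e * y ^ 2 + ((k : ℚ_[2]) + 1) * z ^ 2 = 0 →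
        x = 0 ∧ y = 0 ∧ z = 0) : False :=
    false_of_represents_ternary (by omega) (represents_ternary_of_covering hk hv' hcov hG hs ht)
      hani
  have hA := Represents.four_mul_nsmul_add (n := 2 * (k + 1)) (c := 2 * ((k : ℚ_[2]) + 1))
    (by omega) (by push_cast; rfl)
  have hB (p : ℕ) := Represents.four_mul_nsmul_add (n := 2 * (k - 3)) (c := 2 * ((k : ℚ_[2]) - 3))
    (by omega) (by rw [h3]; push_cast; rfl) p 0
  have hones : Represents ((2 * t₂ + 3 * (4 * q + 1)) • {(1 : ℚ_[2])})
      ((2 * t₂ + 12 * q + 1) • {1} + 0 + ({1} + {1})) := by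
    convert Represents.refl _ using 1
    module
  have hs {p : ℕ} (hp : t₂ = 2 * p) (hA : ∃ x y : ℚ_[2], 2 * ((k : ℚ_[2]) + 1) = x ^ 2 + y ^ 2)
      (hB : ∃ x y : ℚ_[2], 2 * ((k : ℚ_[2]) - 3) = x ^ 2 + y ^ 2) :
      Represents ((2 * t₂) • {1} + 0)
        (t₂ • {2 * ((k : ℚ_[2]) + 1)} + t₂ • {2 * ((k : ℚ_[2]) - 3)}) := by
    have := (Represents.two_mul_nsmul hA0 hA p).add (Represents.two_mul_nsmul hB0 hB p)
    rw [← hp] at this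
    convert this using 1
    module
  rcases h with ⟨hk4, -⟩ | ⟨hk4, hq⟩
  · obtain ⟨r, rfl⟩ : ∃ r, k = 4 * r := ⟨k / 4, by omega⟩
    rw [mul_assoc] at hv'
    -- Divisibility of k(k - 1) by 4 makes `t₂` even. Both k + 1 and k - 3 are 1 modulo 4, so their
    -- doubles are sums of two squares.
    refine key (hs (p := t₂ / 2) (by omega) ?_ ?_) hones fun x y z hxyz => ?_
    · have := PadicTwo.exists_sq_add_sq_eq (n := 4 * r + 1) (by omega)
      exact PadicTwo.exists_sq_add_sq_eq_two_mul (by exact_mod_cast this)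
    · have := PadicTwo.exists_sq_add_sq_eq (n := 4 * r - 3) (by omega)
      exact PadicTwo.exists_sq_add_sq_eq_two_mul (by exact_mod_cast this)
    · exact PadicTwo.anisotropic_one_one (d := 4 * r + 1) (by omega) x y z (by exact_mod_cast hxyz)
  · obtain ⟨j, rfl⟩ : ∃ j, k = 4 * j + 1 := ⟨k / 4, by omega⟩
    -- As `q` is odd, this gives t₂ ≡ 2j mod 4.
    have hv4 : 2 * t₂ + 12 * q + 4 = 4 * (4 * (j * j) + j) := by
      rw [Nat.add_sub_cancel] at hv'
      linarith
    rcases Nat.even_or_odd' j with ⟨i, rfl | rfl⟩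
    · obtain ⟨p, rfl⟩ : ∃ p, t₂ = 4 * p := ⟨t₂ / 4, by omega⟩
      refine key (m := 2 * (4 * p)) (s := 0) ?_ hones fun x y z hxyz => ?_
      · convert (hA p 0).add (hB p) using 1
        · module
        · simp only [add_zero]
      · refine PadicTwo.anisotropic_one_one_two_mul (d := 4 * i + 1) (by omega) x y z ?_
        push_cast at hxyz ⊢
        linear_combination hxyz
    · obtain ⟨p, rfl⟩ : ∃ p, t₂ = 4 * p + 2 := ⟨t₂ / 4, by omega⟩
      -- Now 2(k - 3) = 4(4i + 1) is a sum of two squares, but 2(k + 1) = 4(4i + 3) is not, so its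
      -- copies are traded only in fours and two remain as `s`. Four ones on the other side become
      -- copies of it: two cancel `s`, two are `d` and `e`.
      refine key (m := 8 * p + 2) (s := 2 • {2 * (((4 * (2 * i + 1) + 1 : ℕ) : ℚ_[2]) + 1)})
        (d := 2 * (((4 * (2 * i + 1) + 1 : ℕ) : ℚ_[2]) + 1))
        (e := 2 * (((4 * (2 * i + 1) + 1 : ℕ) : ℚ_[2]) + 1)) ?_ ?_ fun x y z hxyz => ?_
      · have hB' := Represents.two_mul_nsmul hB0 (by
          have := PadicTwo.exists_sq_add_sq_eq (n := 4 * i + 1) (by omega)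
          convert PadicTwo.exists_sq_add_sq_eq_two_mul
            (PadicTwo.exists_sq_add_sq_eq_two_mul this) using 5
          push_cast
          ring) (2 * p + 1)
        convert (hA p 2).add hB' using 1
        · module
        · congr 2
          ring
      · convert (Represents.refl ((8 * p + 12 * q + 3) • {(1 : ℚ_[2])})).add (hA 1 0) using 1
        · module
        · module
      -- The ternary form equals 2(k + 1)(x² + y² + 2(z/2)²).
      · obtain ⟨hx, hy, hz⟩ := PadicTwo.anisotropic_one_one_two_mul (d := 1) rfl x y (z / 2) (by
          refine (mul_eq_zero.1 ?_).resolve_left hA0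
          push_cast at hxyz ⊢
          linear_combination hxyz)
        exact ⟨hx, hy, by simpa using hz⟩
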